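/- Let $L^2$ and $L^\infty$ be the usual spaces on the unit circle $\partial\mathbb D$ with normalised Lebesgue measure, $H^2\subset L^2$ the Hardy space (functions with vanishing negative Fourier coefficients), $P:L^2\to H^2$ the orthogonal projection, and $T_\varphi f=P(\varphi f)$ ($f\in H^2$) the Toeplitz operator with symbol $\varphi\in L^\infty$. A conjugation on a complex Hilbert space is an antilinear map $C$ with $C^2=I$ and $\langle Cx,Cy\rangle=\langle y,x\rangle$; a bounded operator $T$ is complex symmetric with the conjugation $C$ if $T=CT^*C$. Let $C_{1,1}$ be the conjugation $(C_{1,1}f)(z)=\overline{f(\bar z)}$ on $H^2$, and let $\mathcal C=\frac1{\sqrt2}\begin{pmatrix}C_{1,1}&C_{1,1}\\ C_{1,1}&-C_{1,1}\end{pmatrix}$ on $H^2\oplus H^2$. Let $\varphi_1,\varphi_2,\varphi_3,\varphi_4\in L^\infty$, $\Phi=\begin{pmatrix}\varphi_1&\varphi_2\\ \varphi_3&\varphi_4\end{pmatrix}$ and $T_\Phi=\begin{pmatrix}T_{\varphi_1}&T_{\varphi_2}\\ T_{\varphi_3}&T_{\varphi_4}\end{pmatrix}$ on $H^2\oplus H^2$.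 With $\widehat\Phi(n)$ the (matrix) Fourier coefficients of $\Phi$ and $*$ the conjugate transpose of matrices, put $$\Phi_+(z)=\sum_{n\ge1}\widehat\Phi(n)z^n,\qquad \Phi_-(z)=\sum_{n\ge1}\widehat\Phi(-n)^*z^n$$ (series converging in $L^2$), so that $\Phi=\Phi_++\widehat\Phi(0)+\Phi_-^*$. Assume that each $T_{\varphi_j}$ $(j=1,2,3,4)$ is complex symmetric with the conjugation $C_{1,1}$ and that $\varphi_1=\varphi_2+\varphi_3+\varphi_4$. Suppose further that, almost everywhere on $\partial\mathbb D$, $$|\varphi_2|=|\varphi_3|,\qquad (\varphi_1-\varphi_4)\overline{\varphi_3}=(\overline{\varphi_1}-\overline{\varphi_4})\varphi_2,$$ and that there is a constant unitary $2\times2$ matrix $U$ such that, for almost every $z\in\partial\mathbb D$, $$\Phi_-^*(z)=\Phi_+(\bar z)=U\,\Phi_+^*(z).$$ Then $T_\Phi$ is normal, and it is complex symmetric with the conjugation $\mathcal C$. -/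

import Mathlib

open MeasureTheory AddCircle
open scoped ENNReal ComplexConjugate InnerProductSpace

noncomputable section

namespace BlockToeplitz

/-! ### Conjugations and complex symmetric operators -/

/-- A conjugation on a complex inner product space: an antilinear involution `C` with
`⟪C x, C y⟫ = ⟪y, x⟫`. -/
structure Conjugation (H : Type*) [NormedAddCommGroup H] [InnerProductSpace ℂ H] where
  toFun : H → H
  map_add : ∀ x y, toFun (x + y) = toFun x + toFun y
  map_smul : ∀ (c : ℂ) x, toFun (c • x) = conj c • toFun x
  involutive : ∀ x, toFun (toFun x) = x
  inner_map_map : ∀ x y, ⟪toFun x, toFun y⟫_ℂ = ⟪y, x⟫_ℂ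

instance {H : Type*} [NormedAddCommGroup H] [InnerProductSpace ℂ H] :
    CoeFun (Conjugation H) (fun _ => H → H) := ⟨Conjugation.toFun⟩

/-- `T` is complex symmetric with the conjugation `C`: `T = C T* C`. -/
def IsComplexSymmetric {H : Type*} [NormedAddCommGroup H] [InnerProductSpace ℂ H]
    [CompleteSpace H] (C : Conjugation H) (T : H →L[ℂ] H) : Prop :=
  ∀ x, T x = C (ContinuousLinearMap.adjoint T (C x))

/-! ### Function spaces on the unit circle

The circle is parametrised by `t ↦ z = exp (2 π i t)` with `t ∈ ℝ / ℤ`, and carries normalised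
Lebesgue measure. Thus `fourier n t` is `z ^ n`, and `-t` corresponds to the conjugate of `z`. -/

/-- `L²` of the unit circle. -/
abbrev L2 : Type := Lp ℂ 2 (haarAddCircle (T := (1 : ℝ)))

/-- `L^∞` of the unit circle. -/
abbrev Linf : Type := Lp ℂ ∞ (haarAddCircle (T := (1 : ℝ)))

/-- The Hardy space `H²`, as a subspace of `L²`: the functions with vanishing negative Fourier
coefficients. -/
def hardySubmodule : Submodule ℂ L2 where
  carrier := {f | ∀ n : ℤ, n < 0 → fourierCoeff (f : UnitAddCircle → ℂ) n = 0}
  add_mem' := by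
    intro f g hf hg n hn
    have hf' := hf n hn
    have hg' := hg n hn
    rw [← fourierBasis_repr] at hf' hg' ⊢
    simp [hf', hg']
  zero_mem' := by
    intro n _
    rw [← fourierBasis_repr]
    simp
  smul_mem' := by
    intro c f hf n hn
    have hf' := hf n hn
    rw [← fourierBasis_repr] at hf' ⊢
    simp [hf']

theorem mem_hardySubmodule (f : L2) :
    f ∈ hardySubmodule ↔ ∀ n : ℤ, n < 0 → fourierCoeff (f : UnitAddCircle → ℂ) n = 0 := Iff.rfl

theorem isClosed_hardySubmodule : IsClosed (hardySubmodule : Set L2) := by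
  have h : (hardySubmodule : Set L2) =
      ⋂ n : ℤ, ⋂ _ : n < 0, {f : L2 | ⟪(fourierBasis (T := (1 : ℝ)) n : L2), f⟫_ℂ = 0} := by
    ext f
    simp only [SetLike.mem_coe, mem_hardySubmodule, Set.mem_iInter, Set.mem_ofPred_eq, ← fourierBasis_repr,
      HilbertBasis.repr_apply_apply]
  rw [h]
  refine isClosed_iInter fun n => isClosed_iInter fun _ => ?_
  exact isClosed_eq (continuous_const.inner continuous_id) continuous_const

instance : CompleteSpace hardySubmodule := isClosed_hardySubmodule.completeSpace_coe

/-- The Hardy space `H²`, as a Hilbert space. -/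
def H2 : Type := hardySubmodule

instance : NormedAddCommGroup H2 := inferInstanceAs (NormedAddCommGroup hardySubmodule)

instance : InnerProductSpace ℂ H2 := inferInstanceAs (InnerProductSpace ℂ hardySubmodule)

instance : CompleteSpace H2 := inferInstanceAs (CompleteSpace hardySubmodule)

/-- The inclusion of `H²` into `L²`. -/
def inclL2 : H2 →L[ℂ] L2 := hardySubmodule.subtypeL

/-- The orthogonal projection `P` of `L²` onto `H²`. -/
def projH2 : L2 →L[ℂ] H2 := hardySubmodule.orthogonalProjectionOnto

/-! ### Toeplitz operators -/

/-- Multiplication by `φ ∈ L^∞`, as a bounded operator on `L²`. -/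
def mulL2 (φ : Linf) : L2 →L[ℂ] L2 :=
  (ContinuousLinearMap.mul ℂ ℂ).holderL (haarAddCircle (T := (1 : ℝ))) ∞ 2 2 φ

/-- The Toeplitz operator `T_φ f = P (φ f)` on `H²`, where `P` is the orthogonal projection of
`L²` onto `H²`. -/
def toeplitz (φ : Linf) : H2 →L[ℂ] H2 :=
  projH2 ∘L mulL2 φ ∘L inclL2

/-- The bounded operator on `H ⊕ H` (with its Hilbert space structure) with operator matrix `A`. -/
def blockOperator {H : Type*} [NormedAddCommGroup H] [InnerProductSpace ℂ H]
    (A : Matrix (Fin 2) (Fin 2) (H →L[ℂ] H)) :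
    PiLp 2 (fun _ : Fin 2 => H) →L[ℂ] PiLp 2 (fun _ : Fin 2 => H) :=
  (PiLp.continuousLinearEquiv 2 ℂ (fun _ : Fin 2 => H)).symm.toContinuousLinearMap ∘L
    ContinuousLinearMap.pi fun i => ∑ j, A i j ∘L PiLp.proj 2 (fun _ : Fin 2 => H) j

theorem blockOperator_apply {H : Type*} [NormedAddCommGroup H] [InnerProductSpace ℂ H]
    (A : Matrix (Fin 2) (Fin 2) (H →L[ℂ] H)) (x : PiLp 2 (fun _ : Fin 2 => H)) (i : Fin 2) :
    blockOperator A x i = ∑ j, A i j (x j) := by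
  simp [blockOperator]

/-- The block Toeplitz operator `T_Φ` of a matrix symbol `Φ`: the operator on `H² ⊕ H²` with
operator matrix `(T_{Φ i j})`, that is, `Φ h` followed by the entrywise projection onto `H²`. -/
def blockToeplitz (Φ : Matrix (Fin 2) (Fin 2) Linf) :
    PiLp 2 (fun _ : Fin 2 => H2) →L[ℂ] PiLp 2 (fun _ : Fin 2 => H2) :=
  blockOperator (Φ.map toeplitz)

theorem blockToeplitz_apply (Φ : Matrix (Fin 2) (Fin 2) Linf)
    (h : PiLp 2 (fun _ : Fin 2 => H2)) (i : Fin 2) :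
    blockToeplitz Φ h i = projH2 (∑ j, mulL2 (Φ i j) (inclL2 (h j))) := by
  rw [blockToeplitz, blockOperator_apply, map_sum]
  rfl

/-! ### The conjugations `C_{1,1}` and `𝒞` -/

/-- `f ↦ conj (f (conj z))` on `L²`. -/
def flipL2 (f : L2) : L2 :=
  star (Lp.compMeasurePreserving (fun t : UnitAddCircle => -t)
    (Measure.measurePreserving_neg haarAddCircle) f)

theorem coeFn_flipL2 (f : L2) :
    (flipL2 f : UnitAddCircle → ℂ) =ᵐ[haarAddCircle] fun t => conj (f (-t)) := by
  have h1 := Lp.coeFn_star (Lp.compMeasurePreserving (fun t : UnitAddCircle => -t)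
    (Measure.measurePreserving_neg haarAddCircle) f)
  have h2 := Lp.coeFn_compMeasurePreserving f
    (Measure.measurePreserving_neg (haarAddCircle (T := (1 : ℝ))))
  filter_upwards [h1, h2] with t ht1 ht2
  rw [flipL2, ht1, Pi.star_apply, ht2]
  rfl

theorem ae_neg {p : UnitAddCircle → Prop} (h : ∀ᵐ t ∂haarAddCircle, p t) :
    ∀ᵐ t ∂(haarAddCircle (T := (1 : ℝ))), p (-t) :=
  (Measure.measurePreserving_neg (haarAddCircle (T := (1 : ℝ)))).quasiMeasurePreserving.ae h

theorem fourierCoeff_flipL2 (f : L2) (n : ℤ) :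
    fourierCoeff (flipL2 f : UnitAddCircle → ℂ) n =
      conj (fourierCoeff (f : UnitAddCircle → ℂ) n) := by
  rw [fourierCoeff_congr_ae (coeFn_flipL2 f)]
  unfold fourierCoeff
  rw [← integral_conj, ← integral_neg_eq_self]
  refine integral_congr_ae (Filter.Eventually.of_forall fun t => ?_)
  have : (fourier (-n) (-t) : ℂ) = conj (fourier (-n) t : ℂ) := by
    rw [← fourier_neg]
    simp [fourier_apply]
  simp [this]

/-- The conjugation `C_{1,1}` on `H²`: `(C f)(z) = conj (f (conj z))`. -/
def conjH2 : Conjugation H2 where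
  toFun f := ⟨flipL2 (inclL2 f), fun n hn => by
    rw [fourierCoeff_flipL2, (mem_hardySubmodule (inclL2 f)).1 f.2 n hn, map_zero]⟩
  map_add f g := by
    refine Subtype.ext (Lp.ext ?_)
    filter_upwards [coeFn_flipL2 (inclL2 (f + g)), coeFn_flipL2 (inclL2 f),
      coeFn_flipL2 (inclL2 g), Lp.coeFn_add (flipL2 (inclL2 f)) (flipL2 (inclL2 g)),
      ae_neg (Lp.coeFn_add (inclL2 f) (inclL2 g))] with t h1 h2 h3 h4 h5
    rw [_root_.map_add] at h1
    change flipL2 (inclL2 f + inclL2 g) t = (flipL2 (inclL2 f) + flipL2 (inclL2 g) : L2) t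
    rw [h1, h5, h4, Pi.add_apply, Pi.add_apply, h2, h3, _root_.map_add]
  map_smul c f := by
    refine Subtype.ext (Lp.ext ?_)
    filter_upwards [coeFn_flipL2 (inclL2 (c • f)), coeFn_flipL2 (inclL2 f),
      Lp.coeFn_smul (conj c) (flipL2 (inclL2 f)),
      ae_neg (Lp.coeFn_smul c (inclL2 f))] with t h1 h2 h3 h4
    rw [_root_.map_smul] at h1
    change flipL2 (c • inclL2 f) t = (conj c • flipL2 (inclL2 f) : L2) t
    rw [h1, h4, h3, Pi.smul_apply, Pi.smul_apply, h2, smul_eq_mul, smul_eq_mul, map_mul]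
  involutive f := by
    refine Subtype.ext (Lp.ext ?_)
    filter_upwards [coeFn_flipL2 (flipL2 (inclL2 f)),
      ae_neg (coeFn_flipL2 (inclL2 f))] with t h1 h2
    change flipL2 (flipL2 (inclL2 f)) t = inclL2 f t
    rw [h1, h2, neg_neg, Complex.conj_conj]
  inner_map_map f g := by
    change ⟪flipL2 (inclL2 f), flipL2 (inclL2 g)⟫_ℂ = ⟪inclL2 g, inclL2 f⟫_ℂ
    simp only [L2.inner_def]
    rw [← integral_neg_eq_self]
    refine integral_congr_ae ?_
    filter_upwards [ae_neg (coeFn_flipL2 (inclL2 f)), ae_neg (coeFn_flipL2 (inclL2 g))] with t h1 h2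
    rw [h1, h2, neg_neg]
    simp [mul_comm]

/-- From a conjugation `C` on `H`, the conjugation `(x, y) ↦ (C x + C y, C x - C y) / √2` on
`H ⊕ H`. -/
def blockConj {H : Type*} [NormedAddCommGroup H] [InnerProductSpace ℂ H] (C : Conjugation H) :
    Conjugation (PiLp 2 (fun _ : Fin 2 => H)) where
  toFun x := ((1 / √2 : ℝ) : ℂ) • WithLp.toLp 2 ![C (x 0) + C (x 1), C (x 0) - C (x 1)]
  map_add x y := by
    rw [← smul_add]
    congr 1
    ext i
    fin_cases i <;> simp [C.map_add] <;> abel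
  map_smul c x := by
    rw [smul_comm]
    congr 1
    ext i
    fin_cases i <;> simp [C.map_smul, smul_add, smul_sub]
  involutive x := by
    have hneg : ∀ a b, C (a - b) = C a - C b := fun a b => by
      have h := C.map_smul (-1) b
      simp only [neg_smul, one_smul, map_neg, map_one] at h
      rw [sub_eq_add_neg, C.map_add, h, sub_eq_add_neg]
    have hs : (((1 / √2 : ℝ) : ℂ) * ((1 / √2 : ℝ) : ℂ)) * 2 = 1 := by
      rw [← Complex.ofReal_mul, div_mul_div_comm, Real.mul_self_sqrt (by norm_num)]
      norm_num
    ext i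
    fin_cases i <;>
      simp only [PiLp.smul_apply, C.map_smul, C.map_add, hneg, Complex.conj_ofReal,
        C.involutive, ← smul_add, ← smul_sub, smul_smul, Fin.zero_eta, Fin.mk_one,
        Matrix.cons_val_zero, Matrix.cons_val_one]
    · rw [show x 0 + x 1 + (x 0 - x 1) = (2 : ℂ) • x 0 by rw [two_smul]; abel, smul_smul, hs,
        one_smul]
    · rw [show x 0 + x 1 - (x 0 - x 1) = (2 : ℂ) • x 1 by rw [two_smul]; abel, smul_smul, hs,
        one_smul]
  inner_map_map x y := by
    have hs : (((1 / √2 : ℝ) : ℂ) * ((1 / √2 : ℝ) : ℂ)) * 2 = 1 := by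
      rw [← Complex.ofReal_mul, div_mul_div_comm, Real.mul_self_sqrt (by norm_num)]
      norm_num
    simp only [inner_smul_left, inner_smul_right, Complex.conj_ofReal, PiLp.inner_apply,
      Fin.sum_univ_two, Matrix.cons_val_zero, Matrix.cons_val_one, inner_add_left,
      inner_add_right, inner_sub_left, inner_sub_right, C.inner_map_map]
    linear_combination (⟪y 0, x 0⟫_ℂ + ⟪y 1, x 1⟫_ℂ) * hs

/-! ### The decomposition `Φ = Φ₊ + Φ₀ + Φ₋*` of a matrix symbol -/

/-- The `n`-th Fourier coefficient (a matrix) of a matrix symbol. -/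
def fourierMat (Φ : Matrix (Fin 2) (Fin 2) Linf) (n : ℤ) : Matrix (Fin 2) (Fin 2) ℂ :=
  Matrix.of fun i j => fourierCoeff (Φ i j : UnitAddCircle → ℂ) n

/-- The matrix function `∑_{n ≥ 1} A n z ^ n`, each entry being a series in `L²`. -/
def powerSeriesMat (A : ℤ → Matrix (Fin 2) (Fin 2) ℂ) (t : UnitAddCircle) :
    Matrix (Fin 2) (Fin 2) ℂ :=
  Matrix.of fun i j => (∑' n : ℕ, A (n + 1) i j • fourierLp (T := (1 : ℝ)) 2 (n + 1) : L2) t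

/-- The series of `powerSeriesMat` converge in `L²` for the Fourier coefficients of `L^∞` functions,
and for their conjugates. -/
theorem summable_plus (φ : Linf) : Summable fun n : ℕ =>
    fourierCoeff (φ : UnitAddCircle → ℂ) (n + 1) • fourierLp (T := (1 : ℝ)) 2 (n + 1) := by
  have hm : MemLp (φ : UnitAddCircle → ℂ) 2 haarAddCircle := (Lp.memLp φ).mono_exponent le_top
  have h := (hasSum_fourier_series_L2 (hm.toLp _)).summable
  refine (h.comp_injective (i := fun n : ℕ => ((n : ℤ) + 1))
    (fun a b hab => by simpa using hab)).congr fun n => ?_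
  simp [fourierCoeff_congr_ae hm.coeFn_toLp]

theorem summable_minus (φ : Linf) : Summable fun n : ℕ =>
    conj (fourierCoeff (φ : UnitAddCircle → ℂ) (-(n + 1))) •
      fourierLp (T := (1 : ℝ)) 2 (n + 1) := by
  have hs : ∀ n : ℤ, fourierCoeff ((star φ : Linf) : UnitAddCircle → ℂ) n =
      conj (fourierCoeff (φ : UnitAddCircle → ℂ) (-n)) := fun n => by
    rw [fourierCoeff_congr_ae (Lp.coeFn_star φ)]
    unfold fourierCoeff
    rw [← integral_conj]
    refine integral_congr_ae (Filter.Eventually.of_forall fun t => ?_)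
    simp
  exact (summable_plus (star φ)).congr fun n => by rw [hs]

/-- `Φ₊(z) = ∑_{n ≥ 1} Φ̂(n) z ^ n`. -/
def plusPart (Φ : Matrix (Fin 2) (Fin 2) Linf) : UnitAddCircle → Matrix (Fin 2) (Fin 2) ℂ :=
  powerSeriesMat fun n => fourierMat Φ n

/-- `Φ₋(z) = ∑_{n ≥ 1} Φ̂(-n)* z ^ n`, with `*` the conjugate transpose, so that
`Φ₋(z)* = ∑_{n ≥ 1} Φ̂(-n) z ^ (-n)`. -/
def minusPart (Φ : Matrix (Fin 2) (Fin 2) Linf) : UnitAddCircle → Matrix (Fin 2) (Fin 2) ℂ :=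
  powerSeriesMat fun n => (fourierMat Φ (-n)).conjTranspose

end BlockToeplitz

end

/-!
Write `Φ` for the matrix symbol and `M_Φ` for multiplication by `Φ` on `L² ⊕ L²`.

*Normality.* The adjoint of `T_Φ` is the block Toeplitz operator with symbol `Φ*`, so it suffices
that `‖T_Φ h‖ = ‖T_{Φ*} h‖` for `h ∈ H² ⊕ H²`, and by Pythagoras
`‖T_Φ h‖² = ‖M_Φ h‖² - ‖(I - P) M_Φ h‖²`. The two pointwise conditions on the entries say that
`Φ(z)` is a normal matrix almost everywhere, whence `‖M_Φ h‖ = ‖M_{Φ*} h‖`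
(`sum_norm_sq_sum_mulL2`). The condition `Φ₋* = U Φ₊*` says that `Φ - U Φ*` has no negative Fourier
coefficients (`fourierMat_eq_of_minusPart_eq`), so multiplication by it preserves `H² ⊕ H²`
(`mulL2_mem_hardySubmodule`). Hence `(I - P) M_Φ h = U (I - P) M_{Φ*} h` (`coprojH2_sum_mulL2`), and
these two vectors have the same norm as `U` is unitary.

*Complex symmetry.* This is linear algebra with the four entries
(`isComplexSymmetric_blockOperator`): as each `T_{φ_j}` is complex symmetric, conjugating the
adjoint of `T_Φ` by `𝒞` gives the operator matrix `½ S (T_Φ)ᵗ S` with `S = !![1, 1; 1, -1]`, and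
this is `T_Φ` because `φ₁ = φ₂ + φ₃ + φ₄`.
-/

noncomputable section

namespace BlockToeplitz

/-! ### Unitary and normal matrices -/

theorem sum_norm_sq_unitary_smul {n E : Type*} [Fintype n] [DecidableEq n] [NormedAddCommGroup E]
    [InnerProductSpace ℂ E] {U : Matrix n n ℂ} (hU : U ∈ Matrix.unitaryGroup n ℂ) (x : n → E) :
    ∑ i, ‖∑ k, U i k • x k‖ ^ 2 = ∑ k, ‖x k‖ ^ 2 := by
  have hentry : ∀ k l, ∑ i, conj (U i k) * U i l = (1 : Matrix n n ℂ) k l := fun k l => by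
    rw [← Matrix.mem_unitaryGroup_iff'.1 hU]
    simp [Matrix.mul_apply, Matrix.star_apply]
  have hexp : ∀ i, ((‖∑ k, U i k • x k‖ ^ 2 : ℝ) : ℂ) =
      ∑ k, ∑ l, conj (U i k) * U i l * ⟪x k, x l⟫_ℂ := fun i => by
    rw [Complex.ofReal_pow]
    refine (inner_self_eq_norm_sq_to_K (𝕜 := ℂ) (∑ k, U i k • x k)).symm.trans ?_
    rw [sum_inner]
    simp only [inner_sum, inner_smul_left, inner_smul_right, mul_assoc]
    exact Finset.sum_congr rfl fun k _ => Finset.sum_congr rfl fun l _ => mul_left_comm _ _ _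
  rw [← Complex.ofReal_inj, Complex.ofReal_sum, Finset.sum_congr rfl fun i _ => hexp i,
    Finset.sum_comm]
  refine (Finset.sum_congr rfl fun k _ => ?_).trans (Complex.ofReal_sum _ _).symm
  rw [Finset.sum_comm]
  simp only [← Finset.sum_mul, hentry, Matrix.one_apply, ite_mul, one_mul, zero_mul,
    Finset.sum_ite_eq, Finset.mem_univ, if_true, Complex.ofReal_pow]
  exact inner_self_eq_norm_sq_to_K _

theorem sum_norm_sq_mulVec_of_isStarNormal {n : Type*} [Fintype n] {A : Matrix n n ℂ}
    (hA : IsStarNormal A) (v : n → ℂ) :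
    ∑ i, ‖(A.mulVec v) i‖ ^ 2 = ∑ i, ‖(A.conjTranspose.mulVec v) i‖ ^ 2 := by
  have hnorm : ∀ w : n → ℂ, ((∑ i, ‖w i‖ ^ 2 : ℝ) : ℂ) = star w ⬝ᵥ w := fun w => by
    simp [dotProduct, Complex.conj_mul']
  have hstar : A.conjTranspose * A = A * A.conjTranspose := hA.star_comm_self
  rw [← Complex.ofReal_inj, hnorm, hnorm, Matrix.star_mulVec, Matrix.star_mulVec,
    ← Matrix.dotProduct_mulVec, ← Matrix.dotProduct_mulVec, Matrix.mulVec_mulVec,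
    Matrix.mulVec_mulVec, Matrix.conjTranspose_conjTranspose, hstar]

/-! ### Block operators -/

theorem adjoint_blockOperator {H : Type*} [NormedAddCommGroup H] [InnerProductSpace ℂ H]
    [CompleteSpace H] (A : Matrix (Fin 2) (Fin 2) (H →L[ℂ] H)) :
    ContinuousLinearMap.adjoint (blockOperator A) = blockOperator A.conjTranspose := by
  symm
  rw [ContinuousLinearMap.eq_adjoint_iff]
  intro x y
  simp only [PiLp.inner_apply, blockOperator_apply, Fin.sum_univ_two, Matrix.conjTranspose_apply,
    inner_add_left, inner_add_right, ContinuousLinearMap.star_eq_adjoint,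
    ContinuousLinearMap.adjoint_inner_left]
  ring

theorem Conjugation.map_sub {H : Type*} [NormedAddCommGroup H] [InnerProductSpace ℂ H]
    (C : Conjugation H) (x y : H) : C (x - y) = C x - C y := by
  have h := C.map_smul (-1) y
  simp only [neg_smul, one_smul, map_neg, map_one] at h
  rw [sub_eq_add_neg, C.map_add, h, sub_eq_add_neg]

/-- If the entries of an operator matrix are complex symmetric with `C`, then conjugating the
adjoint by `blockConj C` amounts to transposing the matrix and multiplying it on both sides by
`2^(-1/2) !![1, 1; 1, -1]`. The relation between the entries says that this returns the original
matrix. -/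
theorem isComplexSymmetric_blockOperator {H : Type*} [NormedAddCommGroup H]
    [InnerProductSpace ℂ H] [CompleteSpace H] {C : Conjugation H}
    {A : Matrix (Fin 2) (Fin 2) (H →L[ℂ] H)} (hA : ∀ i j, IsComplexSymmetric C (A i j))
    (hsum : A 0 0 = A 0 1 + A 1 0 + A 1 1) :
    IsComplexSymmetric (blockConj C) (blockOperator A) := by
  intro x
  have hs : (((1 / √2 : ℝ) : ℂ) * ((1 / √2 : ℝ) : ℂ)) * 2 = 1 := by
    rw [← Complex.ofReal_mul, div_mul_div_comm, Real.mul_self_sqrt (by norm_num)]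
    norm_num
  have hAC : ∀ i j y, C (ContinuousLinearMap.adjoint (A i j) (C y)) = A i j y :=
    fun i j y => (hA i j y).symm
  have hsum' : ∀ y, A 0 0 y = A 0 1 y + A 1 0 y + A 1 1 y := fun y => by rw [hsum]; rfl
  rw [adjoint_blockOperator]
  ext i
  simp only [blockConj, PiLp.smul_apply, _root_.map_smul, C.map_smul, Complex.conj_ofReal,
    ← smul_add, ← smul_sub]
  generalize ((1 / √2 : ℝ) : ℂ) = s at hs ⊢
  fin_cases i <;>
    simp only [Fin.zero_eta, Fin.mk_one, Fin.isValue, blockOperator_apply, Fin.sum_univ_two,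
      Matrix.conjTranspose_apply, ContinuousLinearMap.star_eq_adjoint, Matrix.cons_val_zero,
      Matrix.cons_val_one, _root_.map_add, _root_.map_sub, C.map_add, C.map_sub, hAC, hsum'] <;>
    rw [← one_smul ℂ (_ + _), ← hs, mul_smul, mul_smul] <;>
    congr 2 <;>
    rw [two_smul] <;>
    abel

/-! ### Multiplication operators on `L²` -/

theorem coeFn_mulL2 (φ : Linf) (f : L2) :
    mulL2 φ f =ᵐ[haarAddCircle] fun t => φ t * f t :=
  ContinuousLinearMap.coeFn_holder (r := 2) (ContinuousLinearMap.mul ℂ ℂ) φ f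

theorem mulL2_add (φ ψ : Linf) : mulL2 (φ + ψ) = mulL2 φ + mulL2 ψ :=
  map_add ((ContinuousLinearMap.mul ℂ ℂ).holderL (haarAddCircle (T := (1 : ℝ))) ∞ 2 2) φ ψ

theorem mulL2_sub (φ ψ : Linf) : mulL2 (φ - ψ) = mulL2 φ - mulL2 ψ :=
  map_sub ((ContinuousLinearMap.mul ℂ ℂ).holderL (haarAddCircle (T := (1 : ℝ))) ∞ 2 2) φ ψ

theorem mulL2_sum_smul {ι : Type*} (s : Finset ι) (c : ι → ℂ) (φ : ι → Linf) :
    mulL2 (∑ k ∈ s, c k • φ k) = ∑ k ∈ s, c k • mulL2 (φ k) := by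
  have h := map_sum ((ContinuousLinearMap.mul ℂ ℂ).holderL (haarAddCircle (T := (1 : ℝ))) ∞ 2 2)
    (fun k => c k • φ k) s
  simp only [map_smul] at h
  exact h

theorem adjoint_mulL2 (φ : Linf) : ContinuousLinearMap.adjoint (mulL2 φ) = mulL2 (star φ) := by
  symm
  rw [ContinuousLinearMap.eq_adjoint_iff]
  intro f g
  rw [L2.inner_def, L2.inner_def]
  refine integral_congr_ae ?_
  filter_upwards [coeFn_mulL2 (star φ) f, coeFn_mulL2 φ g, Lp.coeFn_star φ] with t h1 h2 h3
  rw [h1, h2, h3]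
  simp
  ring

theorem fourierCoeff_eq_inner (f : L2) (n : ℤ) :
    fourierCoeff (f : UnitAddCircle → ℂ) n = ⟪(fourierLp 2 n : L2), f⟫_ℂ := by
  rw [← fourierBasis_repr, HilbertBasis.repr_apply_apply, coe_fourierBasis]

theorem fourierCoeff_mulL2_fourierLp (φ : Linf) (n k : ℤ) :
    fourierCoeff (mulL2 φ (fourierLp 2 k) : UnitAddCircle → ℂ) n =
      fourierCoeff (φ : UnitAddCircle → ℂ) (n - k) := by
  refine integral_congr_ae ?_
  filter_upwards [coeFn_mulL2 φ (fourierLp 2 k), coeFn_fourierLp (T := (1 : ℝ)) 2 k] with t h1 h2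
  rw [h1, h2, show -(n - k) = -n + k by ring, fourier_add]
  simp only [smul_eq_mul]
  ring

theorem fourierCoeff_star (φ : Linf) (n : ℤ) :
    fourierCoeff ((star φ : Linf) : UnitAddCircle → ℂ) n =
      conj (fourierCoeff (φ : UnitAddCircle → ℂ) (-n)) := by
  rw [fourierCoeff_congr_ae (Lp.coeFn_star φ)]
  unfold fourierCoeff
  rw [← integral_conj]
  refine integral_congr_ae (Filter.Eventually.of_forall fun t => ?_)
  simp

theorem fourierCoeff_eq_inner_mulL2 (φ : Linf) (n : ℤ) :
    fourierCoeff (φ : UnitAddCircle → ℂ) n =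
      ⟪(fourierLp 2 n : L2), mulL2 φ (fourierLp 2 0)⟫_ℂ := by
  rw [← fourierCoeff_eq_inner, fourierCoeff_mulL2_fourierLp, sub_zero]

/-- A bounded function whose negative Fourier coefficients vanish multiplies `H²` into itself:
by Parseval, a negative coefficient of the product is a convolution all of whose terms vanish. -/
theorem mulL2_mem_hardySubmodule {φ : Linf}
    (hφ : ∀ n : ℤ, n < 0 → fourierCoeff (φ : UnitAddCircle → ℂ) n = 0)
    {f : L2} (hf : f ∈ hardySubmodule) : mulL2 φ f ∈ hardySubmodule := by
  intro n hn
  rw [fourierCoeff_eq_inner, ← ContinuousLinearMap.adjoint_inner_left,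
    ← fourierBasis.tsum_inner_mul_inner]
  refine (tsum_congr fun k => ?_).trans tsum_zero
  rw [coe_fourierBasis]
  rcases lt_or_ge k 0 with hk | hk
  · rw [← fourierCoeff_eq_inner, hf k hk, mul_zero]
  · rw [ContinuousLinearMap.adjoint_inner_left, ← fourierCoeff_eq_inner,
      fourierCoeff_mulL2_fourierLp, hφ _ (by omega), zero_mul]

theorem norm_sq_eq_integral (f : L2) : ‖f‖ ^ 2 = ∫ t, ‖f t‖ ^ 2 ∂haarAddCircle := by
  rw [← Complex.ofReal_inj, ← integral_complex_ofReal, Complex.ofReal_pow]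
  refine (inner_self_eq_norm_sq_to_K (𝕜 := ℂ) f).symm.trans ?_
  rw [L2.inner_def]
  refine integral_congr_ae (Filter.Eventually.of_forall fun t => ?_)
  simp [inner_self_eq_norm_sq_to_K]

theorem sum_norm_sq_eq_integral (f : Fin 2 → L2) :
    ∑ i, ‖f i‖ ^ 2 = ∫ t, ∑ i, ‖f i t‖ ^ 2 ∂haarAddCircle := by
  rw [integral_finsetSum _ fun i _ => (Lp.memLp (f i)).integrable_norm_pow (by simp)]
  exact Finset.sum_congr rfl fun i _ => norm_sq_eq_integral (f i)

theorem coeFn_sum_mulL2 (Φ : Matrix (Fin 2) (Fin 2) Linf) (f : Fin 2 → L2) :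
    ∀ᵐ t ∂haarAddCircle, ∀ i, (∑ j, mulL2 (Φ i j) (f j) : L2) t =
      (Φ.map fun φ => φ t).mulVec (fun j => f j t) i := by
  rw [ae_all_iff]
  intro i
  simp only [Fin.sum_univ_two]
  filter_upwards [Lp.coeFn_add (mulL2 (Φ i 0) (f 0)) (mulL2 (Φ i 1) (f 1)),
    coeFn_mulL2 (Φ i 0) (f 0), coeFn_mulL2 (Φ i 1) (f 1)] with t h1 h2 h3
  rw [h1, Pi.add_apply, h2, h3]
  simp [Matrix.mulVec, dotProduct]

theorem conjTranspose_symbol_ae (Φ : Matrix (Fin 2) (Fin 2) Linf) :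
    ∀ᵐ t ∂haarAddCircle, (Φ.conjTranspose.map fun φ => φ t) =
      (Φ.map fun φ => φ t).conjTranspose := by
  have h : ∀ᵐ t ∂haarAddCircle, ∀ i j, (star (Φ i j) : Linf) t = conj (Φ i j t) := by
    rw [ae_all_iff]
    intro i
    rw [ae_all_iff]
    exact fun j => Lp.coeFn_star (Φ i j)
  filter_upwards [h] with t ht
  ext i j
  exact ht j i

/-- Multiplication by an almost everywhere normal matrix symbol is a normal operator. -/
theorem sum_norm_sq_sum_mulL2 {Φ : Matrix (Fin 2) (Fin 2) Linf}
    (hΦ : ∀ᵐ t ∂haarAddCircle, IsStarNormal (Φ.map fun φ => φ t)) (f : Fin 2 → L2) :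
    ∑ i, ‖∑ j, mulL2 (Φ i j) (f j)‖ ^ 2 =
      ∑ i, ‖∑ j, mulL2 (Φ.conjTranspose i j) (f j)‖ ^ 2 := by
  rw [sum_norm_sq_eq_integral, sum_norm_sq_eq_integral]
  refine integral_congr_ae ?_
  filter_upwards [hΦ, coeFn_sum_mulL2 Φ f, coeFn_sum_mulL2 Φ.conjTranspose f,
    conjTranspose_symbol_ae Φ] with t h1 h2 h3 h4
  simp only [h2, h3, h4]
  exact sum_norm_sq_mulVec_of_isStarNormal h1 _

/-! ### Toeplitz operators -/

theorem toeplitz_add (φ ψ : Linf) : toeplitz (φ + ψ) = toeplitz φ + toeplitz ψ := by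
  simp only [toeplitz, mulL2_add, ContinuousLinearMap.add_comp, ContinuousLinearMap.comp_add]

theorem adjoint_inclL2 : ContinuousLinearMap.adjoint inclL2 = projH2 :=
  hardySubmodule.adjoint_subtypeL

theorem adjoint_toeplitz (φ : Linf) :
    ContinuousLinearMap.adjoint (toeplitz φ) = toeplitz (star φ) := by
  rw [toeplitz, ContinuousLinearMap.adjoint_comp, ContinuousLinearMap.adjoint_comp,
    ← adjoint_inclL2, ContinuousLinearMap.adjoint_adjoint, adjoint_mulL2,
    toeplitz, adjoint_inclL2]
  rfl

theorem adjoint_blockToeplitz (Φ : Matrix (Fin 2) (Fin 2) Linf) :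
    ContinuousLinearMap.adjoint (blockToeplitz Φ) = blockToeplitz Φ.conjTranspose := by
  rw [blockToeplitz, adjoint_blockOperator, blockToeplitz]
  congr 1
  ext1 i j
  exact adjoint_toeplitz (Φ j i)

/-- The orthogonal projection of `L²` onto the orthogonal complement of `H²`. -/
def coprojH2 : L2 →L[ℂ] hardySubmoduleᗮ := hardySubmoduleᗮ.orthogonalProjectionOnto

theorem norm_sq_projH2_add_norm_sq_coprojH2 (f : L2) :
    ‖projH2 f‖ ^ 2 + ‖coprojH2 f‖ ^ 2 = ‖f‖ ^ 2 :=
  (Submodule.norm_sq_eq_add_norm_sq_projection f hardySubmodule).symm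

theorem coprojH2_eq_zero {f : L2} (hf : f ∈ hardySubmodule) : coprojH2 f = 0 :=
  Submodule.orthogonalProjectionOnto_orthogonal_apply_eq_zero hf

/-- The Hankel parts of `Φ` and `Φ*` agree up to a constant unitary factor: `Φ - U Φ*` has no
negative Fourier coefficients, so it maps `H² ⊕ H²` into itself. -/
theorem coprojH2_sum_mulL2 {Φ : Matrix (Fin 2) (Fin 2) Linf} {U : Matrix (Fin 2) (Fin 2) ℂ}
    (hU : ∀ n : ℤ, n < 0 → fourierMat Φ n = U * (fourierMat Φ (-n)).conjTranspose)
    {f : Fin 2 → L2} (hf : ∀ j, f j ∈ hardySubmodule) (i : Fin 2) :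
    coprojH2 (∑ j, mulL2 (Φ i j) (f j)) =
      ∑ k, U i k • coprojH2 (∑ j, mulL2 (Φ.conjTranspose k j) (f j)) := by
  have hmem : ∀ j, mulL2 (Φ i j - ∑ k, U i k • star (Φ j k)) (f j) ∈ hardySubmodule := fun j => by
    refine mulL2_mem_hardySubmodule (fun n hn => ?_) (hf j)
    have h := congrFun (congrFun (hU n hn) i) j
    simp only [fourierMat, Matrix.of_apply, Matrix.mul_apply, Matrix.conjTranspose_apply,
      RCLike.star_def, ← fourierCoeff_star] at h
    simp only [fourierCoeff_eq_inner_mulL2] at h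
    rw [fourierCoeff_eq_inner_mulL2, mulL2_sub, mulL2_sum_smul]
    simp only [_root_.sub_apply, _root_.sum_apply,
      _root_.smul_apply, inner_sub_right, inner_sum, inner_smul_right]
    exact sub_eq_zero.2 h
  have h := coprojH2_eq_zero (hardySubmodule.sum_mem fun j (_ : j ∈ Finset.univ) => hmem j)
  simp only [mulL2_sub, mulL2_sum_smul, _root_.sub_apply,
    _root_.sum_apply, _root_.smul_apply, Finset.sum_sub_distrib,
    map_sub, sub_eq_zero] at h
  rw [h, Finset.sum_comm]
  simp only [← Finset.smul_sum, map_sum, map_smul]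
  rfl

/-- A block Toeplitz operator is normal if its symbol is normal almost everywhere and if, up to a
constant unitary factor, the symbol and its adjoint have the same negative Fourier coefficients. -/
theorem isStarNormal_blockToeplitz {Φ : Matrix (Fin 2) (Fin 2) Linf}
    (hΦ : ∀ᵐ t ∂haarAddCircle, IsStarNormal (Φ.map fun φ => φ t))
    {U : Matrix (Fin 2) (Fin 2) ℂ} (hUU : U ∈ Matrix.unitaryGroup (Fin 2) ℂ)
    (hU : ∀ n : ℤ, n < 0 → fourierMat Φ n = U * (fourierMat Φ (-n)).conjTranspose) :
    IsStarNormal (blockToeplitz Φ) := by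
  rw [ContinuousLinearMap.isStarNormal_iff_norm_eq_adjoint]
  intro h
  have hM := sum_norm_sq_sum_mulL2 hΦ fun j => inclL2 (h j)
  have hH : ∑ i, ‖coprojH2 (∑ j, mulL2 (Φ i j) (inclL2 (h j)))‖ ^ 2 =
      ∑ i, ‖coprojH2 (∑ j, mulL2 (Φ.conjTranspose i j) (inclL2 (h j)))‖ ^ 2 := by
    refine Eq.trans (Finset.sum_congr rfl fun i _ => ?_) (sum_norm_sq_unitary_smul hUU _)
    rw [coprojH2_sum_mulL2 hU (f := fun j => inclL2 (h j)) (fun j => (h j).2) i]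
  rw [adjoint_blockToeplitz, ← sq_eq_sq₀ (norm_nonneg _) (norm_nonneg _), PiLp.norm_sq_eq_of_L2,
    PiLp.norm_sq_eq_of_L2]
  simp only [blockToeplitz_apply]
  simp only [← norm_sq_projH2_add_norm_sq_coprojH2, Finset.sum_add_distrib] at hM
  linarith

/-! ### The analytic and co-analytic parts of the symbol -/

/-- The entries of `powerSeriesMat A` as elements of `L²`. -/
def powerSeriesLp (A : ℤ → Matrix (Fin 2) (Fin 2) ℂ) (i j : Fin 2) : L2 :=
  ∑' n : ℕ, A (n + 1) i j • fourierLp (T := (1 : ℝ)) 2 (n + 1)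

theorem fourierCoeff_powerSeriesLp {A : ℤ → Matrix (Fin 2) (Fin 2) ℂ} {i j : Fin 2}
    (hA : Summable fun n : ℕ => A (n + 1) i j • fourierLp (T := (1 : ℝ)) 2 (n + 1)) (n : ℕ) :
    fourierCoeff (powerSeriesLp A i j : UnitAddCircle → ℂ) (n + 1) = A (n + 1) i j := by
  have h := hA.hasSum.mapL (innerSL ℂ (fourierLp 2 (n + 1) : L2))
  rw [fourierCoeff_eq_inner]
  refine h.unique ?_
  convert! hasSum_ite_eq n (A (n + 1) i j) using 1
  ext m
  have ho := orthonormal_iff_ite.1 (orthonormal_fourier (T := (1 : ℝ))) (n + 1) (m + 1)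
  simp only [innerSL_apply_apply, inner_smul_right]
  rw [ho]
  by_cases hmn : m = n
  · simp [hmn]
  · simp [hmn, Ne.symm hmn]

/-- Comparing Fourier coefficients in `Φ₋* = U Φ₊*`. -/
theorem fourierMat_eq_of_minusPart_eq {Φ : Matrix (Fin 2) (Fin 2) Linf}
    {U : Matrix (Fin 2) (Fin 2) ℂ}
    (h : ∀ᵐ t ∂(haarAddCircle (T := (1 : ℝ))),
      (minusPart Φ t).conjTranspose = U * (plusPart Φ t).conjTranspose)
    (n : ℤ) (hn : n < 0) : fourierMat Φ n = U * (fourierMat Φ (-n)).conjTranspose := by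
  obtain ⟨m, rfl⟩ : ∃ m : ℕ, n = -((m : ℤ) + 1) := ⟨(-n - 1).toNat, by omega⟩
  ext i j
  have hM := fourierCoeff_powerSeriesLp (A := fun n => (fourierMat Φ (-n)).conjTranspose)
    (i := j) (j := i) (summable_minus (Φ i j)) m
  have hP : ∀ k, _ := fun k => fourierCoeff_powerSeriesLp (A := fun n => fourierMat Φ n)
    (i := j) (j := k) (summable_plus (Φ j k)) m
  have hae : ∀ᵐ t ∂(haarAddCircle (T := (1 : ℝ))),
      conj (powerSeriesLp (fun n => (fourierMat Φ (-n)).conjTranspose) j i t) =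
        U i 0 * conj (powerSeriesLp (fun n => fourierMat Φ n) j 0 t) +
          U i 1 * conj (powerSeriesLp (fun n => fourierMat Φ n) j 1 t) :=
    h.mono fun t ht => (congrFun (congrFun ht i) j).trans
      (Matrix.mul_apply.trans (Fin.sum_univ_two _))
  generalize powerSeriesLp (fun n => (fourierMat Φ (-n)).conjTranspose) j i = M at hM hae
  generalize powerSeriesLp (fun n => fourierMat Φ n) j = P at hP hae
  have hLp : M = conj (U i 0) • P 0 + conj (U i 1) • P 1 := by
    refine Lp.ext ?_
    filter_upwards [hae, Lp.coeFn_add (conj (U i 0) • P 0) (conj (U i 1) • P 1),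
      Lp.coeFn_smul (conj (U i 0)) (P 0), Lp.coeFn_smul (conj (U i 1)) (P 1)] with t h1 h2 h3 h4
    have h5 := congrArg conj h1
    rw [h2, Pi.add_apply, h3, h4]
    simpa using h5
  rw [fourierCoeff_eq_inner, hLp, inner_add_right, inner_smul_right, inner_smul_right,
    ← fourierCoeff_eq_inner, ← fourierCoeff_eq_inner, hP, hP, Matrix.conjTranspose_apply] at hM
  have hM' := congrArg conj hM
  simp only [map_add, map_mul, Complex.conj_conj, RCLike.star_def] at hM'
  rw [Matrix.mul_apply, Fin.sum_univ_two, neg_neg]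
  exact hM'.symm

end BlockToeplitz

end

theorem proposition4p6 (φ₁ φ₂ φ₃ φ₄ : BlockToeplitz.Linf)
    (h₁ : BlockToeplitz.IsComplexSymmetric BlockToeplitz.conjH2 (BlockToeplitz.toeplitz φ₁))
    (h₂ : BlockToeplitz.IsComplexSymmetric BlockToeplitz.conjH2 (BlockToeplitz.toeplitz φ₂))
    (h₃ : BlockToeplitz.IsComplexSymmetric BlockToeplitz.conjH2 (BlockToeplitz.toeplitz φ₃))
    (h₄ : BlockToeplitz.IsComplexSymmetric BlockToeplitz.conjH2 (BlockToeplitz.toeplitz φ₄))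
    (hsum : φ₁ = φ₂ + φ₃ + φ₄)
    (habs : ∀ᵐ t ∂(haarAddCircle (T := (1 : ℝ))), ‖φ₂ t‖ = ‖φ₃ t‖)
    (hcomm : ∀ᵐ t ∂(haarAddCircle (T := (1 : ℝ))),
      (φ₁ t - φ₄ t) * conj (φ₃ t) = (conj (φ₁ t) - conj (φ₄ t)) * φ₂ t)
    (hU : ∃ U ∈ Matrix.unitaryGroup (Fin 2) ℂ, ∀ᵐ t ∂(haarAddCircle (T := (1 : ℝ))),
      (BlockToeplitz.minusPart !![φ₁, φ₂; φ₃, φ₄] t).conjTranspose =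
          BlockToeplitz.plusPart !![φ₁, φ₂; φ₃, φ₄] (-t) ∧
        BlockToeplitz.plusPart !![φ₁, φ₂; φ₃, φ₄] (-t) =
          U * (BlockToeplitz.plusPart !![φ₁, φ₂; φ₃, φ₄] t).conjTranspose) :
    IsStarNormal (BlockToeplitz.blockToeplitz !![φ₁, φ₂; φ₃, φ₄]) ∧
      BlockToeplitz.IsComplexSymmetric (BlockToeplitz.blockConj BlockToeplitz.conjH2)
        (BlockToeplitz.blockToeplitz !![φ₁, φ₂; φ₃, φ₄]) := by
  obtain ⟨U, hUU, hU⟩ := hU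
  constructor
  · refine BlockToeplitz.isStarNormal_blockToeplitz ?_ hUU
      (BlockToeplitz.fourierMat_eq_of_minusPart_eq (hU.mono fun t ht => ht.1.trans ht.2))
    filter_upwards [habs, hcomm] with t ha hc
    have ha' : conj (φ₂ t) * φ₂ t = conj (φ₃ t) * φ₃ t := by
      rw [Complex.conj_mul', Complex.conj_mul', ha]
    have hc' := congrArg conj hc
    simp only [map_mul, map_sub, Complex.conj_conj] at hc'
    refine ⟨?_⟩
    ext i j
    fin_cases i <;> fin_cases j <;>
      simp [Matrix.mul_apply, Matrix.star_apply]
    · linear_combination -ha'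
    · linear_combination -hc
    · linear_combination -hc'
    · linear_combination ha'
  · refine BlockToeplitz.isComplexSymmetric_blockOperator (fun i j => ?_) ?_
    · fin_cases i <;> fin_cases j <;> assumption
    · simp only [Matrix.map_apply, Matrix.of_apply, Matrix.cons_val', Matrix.cons_val_zero,
        Matrix.cons_val_one, ← BlockToeplitz.toeplitz_add, hsum]
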